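/- Let $K$ be a field of characteristic zero, $d$ a natural number and $A=(a_{ij})$ a $d\times d$ matrix over $K$. For $1\le i\le d$ put $L_i=a_{i1}X_1+\dots+a_{id}X_d$, $H_i=L_i^3$ and $F_i=X_i+H_i$ in $K[X_1,\dots,X_d]$, and let $JH=(\partial H_i/\partial X_j)_{1\le i,j\le d}$ be the Jacobian matrix of $H=(H_1,\dots,H_d)$. For each $i$ define polynomials $P_j^i\in K[X_1,\dots,X_d]$ by $P_0^i=X_i$, $P_1^i=H_i$ and $$P_j^i(X_1,\dots,X_d)=P_{j-1}^i(F_1,\dots,F_d)-P_{j-1}^i(X_1,\dots,X_d)\qquad(j\ge 2).$$ If $(JH)^3=0$, then for every $i=1,\dots,d$: (a) $\deg P_j^i\le 9$ for $j=2,3,4$; (b) $P_5^i=0$; (c) $P_4^i=6\sum_{j,k,l=1}^d a_{ij}a_{ik}a_{il}\,L_j^3L_k^3L_l^3$. Here $\deg$ is the total degree, and the zero polynomial satisfies every degree bound. -/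

import Mathlib

noncomputable section

namespace Druzkowski

open MvPolynomial

variable {K : Type*} [Field K] {d : ℕ}

/-- The linear form `L_i = a_{i1} X_1 + ⋯ + a_{id} X_d`. -/
def linForm (A : Matrix (Fin d) (Fin d) K) (i : Fin d) : MvPolynomial (Fin d) K :=
  ∑ j, C (A i j) * X j

/-- The cubic map `H = (L_1 ^ 3, …, L_d ^ 3)`. -/
def cubicPart (A : Matrix (Fin d) (Fin d) K) (i : Fin d) : MvPolynomial (Fin d) K :=
  linForm A i ^ 3

/-- The Jacobian matrix `(∂H_i/∂X_j)` of a polynomial map. -/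
def jacobian (H : Fin d → MvPolynomial (Fin d) K) :
    Matrix (Fin d) (Fin d) (MvPolynomial (Fin d) K) :=
  Matrix.of fun i j => pderiv j (H i)

/-- The polynomial map `F = Id + H`. -/
def idAdd (H : Fin d → MvPolynomial (Fin d) K) (i : Fin d) : MvPolynomial (Fin d) K :=
  X i + H i

/-- The sequence `P_0^i = X_i`, `P_1^i = H_i`,
`P_j^i = P_{j-1}^i(F_1, …, F_d) - P_{j-1}^i(X_1, …, X_d)` for `j ≥ 2`, where `F = Id + H`;
`bind₁ F` is the substitution `X_k ↦ F_k`. -/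
def pSeq (H : Fin d → MvPolynomial (Fin d) K) (i : Fin d) : ℕ → MvPolynomial (Fin d) K
  | 0 => X i
  | 1 => H i
  | j + 2 => bind₁ (idAdd H) (pSeq H i (j + 1)) - pSeq H i (j + 1)

end Druzkowski

end

/-!
Write `M_i = L_i(H)`, so that `L_i(F) = L_i + M_i`, and let `D = ∑ H_k ∂/∂X_k`. By Euler's
identity `JH · X = 3 H`, and `JH · H = D H` by the chain rule, so `(JH)³ = 0` yields
`JH · (D H) = 0`. Its `i`-th entry is `3 L_i² · D M_i`, whence `D M_i = 0`. Since `D L_j = M_j` and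
`D M_j = 0`, the Taylor expansion `(L_j + M_j)³ = (1 + D + D² / 2 + D³ / 6) L_j³`, summed over `j`
with weights `a_{ij}`, shows that `M_i(F) = M_i`. Hence the `n`-th iterate of the substitution
`X ↦ F` sends `H_i = L_i³` to `(L_i + n M_i)³`, and `P_{j+1}^i` is the `j`-th finite difference at
`n = 0` of this cubic polynomial in `n`.
-/

namespace Druzkowski

open MvPolynomial
open scoped Matrix

section FiniteDifferences

theorem iterate_map_sub_self_eq_fwdDiff_iter {G F : Type*} [AddCommGroup G] [FunLike F G G]
    [AddMonoidHomClass F G G] (σ : F) (j : ℕ) (x : G) :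
    (fun y => σ y - y)^[j] x = (fwdDiff 1)^[j] (fun n : ℕ => σ^[n] x) 0 := by
  induction j generalizing x with
  | zero => rfl
  | succ j ih =>
    have fwdDiff_iterate : fwdDiff 1 (fun n : ℕ => σ^[n] x) = fun n => σ^[n] (σ x - x) := by
      ext n
      rw [fwdDiff, iterate_map_sub, Function.iterate_succ_apply]
    rw [Function.iterate_succ_apply, Function.iterate_succ_apply, ih, fwdDiff_iterate]

theorem iterate_map_eq_add_nsmul {G F : Type*} [AddMonoid G] [FunLike F G G]
    [AddMonoidHomClass F G G] (σ : F) {a b : G} (ha : σ a = a + b) (hb : σ b = b) (n : ℕ) :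
    σ^[n] a = a + n • b := by
  induction n with
  | zero => simp
  | succ n ih =>
    rw [Function.iterate_succ_apply', ih, map_add, map_nsmul, ha, hb, add_assoc, succ_nsmul']

theorem fwdDiff_iter_three_add_nsmul_pow_three {S : Type*} [CommRing S] (a b : S) :
    (fwdDiff 1)^[3] (fun n : ℕ => (a + n • b) ^ 3) = fun _ => 6 * b ^ 3 := by
  ext n
  simp only [Function.iterate_succ, Function.iterate_zero, Function.comp_apply, id_eq, fwdDiff,
    nsmul_eq_mul, Nat.cast_add, Nat.cast_one]
  ring

theorem fwdDiff_iter_four_add_nsmul_pow_three {S : Type*} [CommRing S] (a b : S) :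
    (fwdDiff 1)^[4] (fun n : ℕ => (a + n • b) ^ 3) = fun _ => 0 := by
  rw [Function.iterate_succ_apply', fwdDiff_iter_three_add_nsmul_pow_three, fwdDiff_const]

theorem totalDegree_fwdDiff_iter_le {σ R M : Type*} [CommRing R] [AddCommMonoid M] (h : M)
    {f : M → MvPolynomial σ R} {N : ℕ} (hf : ∀ m, (f m).totalDegree ≤ N) (j : ℕ) (m : M) :
    ((fwdDiff h)^[j] f m).totalDegree ≤ N := by
  induction j generalizing f with
  | zero => exact hf m
  | succ _ ih => exact ih fun m => (totalDegree_sub _ _).trans (max_le (hf _) (hf m))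

end FiniteDifferences

section Derivations

theorem derivation_eq_zero_of_pow {R S : Type*} [CommSemiring R] [CommRing S] [NoZeroDivisors S]
    [Algebra R S] (D : Derivation R S S) {n : ℕ} (hn : (n : S) ≠ 0) {a : S}
    (h : D (a ^ n) = 0) : D a = 0 := by
  obtain rfl | ha := eq_or_ne a 0
  · exact map_zero D
  · simpa [Derivation.leibniz_pow, hn, pow_ne_zero _ ha] using h

theorem six_mul_add_pow_three {R S : Type*} [CommSemiring R] [CommRing S] [Algebra R S]
    (D : Derivation R S S) {a b : S} (ha : D a = b) (hb : D b = 0) :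
    6 * (a + b) ^ 3 = 6 * a ^ 3 + 6 * D (a ^ 3) + 3 * D (D (a ^ 3)) + D (D (D (a ^ 3))) := by
  have cube_deriv : D (a ^ 3) = 3 • (a ^ 2 * b) := by
    simp [Derivation.leibniz_pow, ha]
  have cube_deriv_two : D (3 • (a ^ 2 * b)) = 6 • (a * b ^ 2) := by
    simp only [map_nsmul, Derivation.leibniz, Derivation.leibniz_pow, ha, hb, smul_eq_mul]
    ring
  have cube_deriv_three : D (6 • (a * b ^ 2)) = 6 • b ^ 3 := by
    simp only [map_nsmul, Derivation.leibniz, Derivation.leibniz_pow, ha, hb, smul_eq_mul]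
    ring
  rw [cube_deriv, cube_deriv_two, cube_deriv_three]
  ring

theorem derivation_sum_C_mul {σ R ι : Type*} [CommSemiring R]
    (D : Derivation R (MvPolynomial σ R) (MvPolynomial σ R)) (s : Finset ι) (c : ι → R)
    (p : ι → MvPolynomial σ R) : D (∑ j ∈ s, C (c j) * p j) = ∑ j ∈ s, C (c j) * D (p j) := by
  simp [Derivation.leibniz]

theorem mkDerivation_apply_eq_sum {σ R : Type*} [Fintype σ] [CommSemiring R]
    (v : σ → MvPolynomial σ R) (p : MvPolynomial σ R) :
    mkDerivation R v p = ∑ j, pderiv j p * v j := by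
  classical
  induction p using MvPolynomial.induction_on with
  | C a => simp
  | add p q hp hq => simp [hp, hq, add_mul, Finset.sum_add_distrib]
  | mul_X p i hp =>
    simp [Derivation.leibniz, hp, pderiv_X, Pi.single_apply, add_mul, Finset.sum_add_distrib,
      Finset.mul_sum, mul_assoc]

end Derivations

variable {K : Type*} [Field K] {d : ℕ}

section Jacobian

variable (H : Fin d → MvPolynomial (Fin d) K)

theorem jacobian_mulVec (v : Fin d → MvPolynomial (Fin d) K) :
    jacobian H *ᵥ v = fun i => mkDerivation K v (H i) := by
  ext1 i
  rw [mkDerivation_apply_eq_sum]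
  rfl

variable {H}

theorem jacobian_mulVec_X {n : ℕ} (hH : ∀ i, (H i).IsHomogeneous n) :
    jacobian H *ᵥ X = n • H := by
  ext1 i
  simp only [jacobian_mulVec, mkDerivation_apply_eq_sum, mul_comm _ (X _),
    (hH i).sum_X_mul_pderiv, Pi.smul_apply]

theorem jacobian_pow_mulVec_self {n m : ℕ} (hn : (n : K) ≠ 0) (hH : ∀ i, (H i).IsHomogeneous n)
    (hJ : jacobian H ^ (m + 1) = 0) : jacobian H ^ m *ᵥ H = 0 := by
  have nsmul_eq_zero : n • (jacobian H ^ m *ᵥ H) = 0 := by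
    rw [← Matrix.mulVec_smul, ← jacobian_mulVec_X hH, Matrix.mulVec_mulVec, ← pow_succ, hJ,
      Matrix.zero_mulVec]
  rw [← Nat.cast_smul_eq_nsmul K] at nsmul_eq_zero
  exact (smul_eq_zero.mp nsmul_eq_zero).resolve_left hn

end Jacobian

theorem pSeq_succ_eq_iterate (H : Fin d → MvPolynomial (Fin d) K) (i : Fin d) (j : ℕ) :
    pSeq H i (j + 1) = (fun p => bind₁ (idAdd H) p - p)^[j] (H i) := by
  induction j with
  | zero => rfl
  | succ j ih => rw [Function.iterate_succ_apply', ← ih, pSeq]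

/-- The increments `M_i = L_i(F) - L_i = L_i(H)` of the linear forms under `X ↦ F`. -/
noncomputable def linIncrement (A : Matrix (Fin d) (Fin d) K) (i : Fin d) :
    MvPolynomial (Fin d) K :=
  ∑ j, C (A i j) * cubicPart A j

variable (A : Matrix (Fin d) (Fin d) K) (i : Fin d)

theorem isHomogeneous_linForm : (linForm A i).IsHomogeneous 1 :=
  .sum _ _ _ fun j _ => isHomogeneous_C_mul_X (A i j) j

theorem isHomogeneous_cubicPart : (cubicPart A i).IsHomogeneous 3 :=
  (isHomogeneous_linForm A i).pow 3

theorem isHomogeneous_linIncrement : (linIncrement A i).IsHomogeneous 3 :=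
  .sum _ _ _ fun j _ => (isHomogeneous_cubicPart A j).C_mul (A i j)

theorem mkDerivation_linForm (v : Fin d → MvPolynomial (Fin d) K) :
    mkDerivation K v (linForm A i) = ∑ j, C (A i j) * v j := by
  simp only [linForm, derivation_sum_C_mul, mkDerivation_X]

theorem bind₁_linForm :
    bind₁ (idAdd (cubicPart A)) (linForm A i) = linForm A i + linIncrement A i := by
  simp [linForm, linIncrement, idAdd, mul_add, Finset.sum_add_distrib]

theorem bind₁_linIncrement_eq_sum :
    bind₁ (idAdd (cubicPart A)) (linIncrement A i) =
      ∑ j, C (A i j) * (linForm A j + linIncrement A j) ^ 3 := by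
  simp [linIncrement, cubicPart, bind₁_linForm]

theorem linIncrement_pow_three :
    linIncrement A i ^ 3 = ∑ j, ∑ k, ∑ l, C (A i j * A i k * A i l) *
      (linForm A j ^ 3 * linForm A k ^ 3 * linForm A l ^ 3) := by
  rw [pow_three, linIncrement, Finset.sum_mul_sum, Finset.sum_mul_sum]
  refine Finset.sum_congr rfl fun j _ => ?_
  simp only [Finset.mul_sum, C_mul, cubicPart]
  exact Finset.sum_congr rfl fun k _ => Finset.sum_congr rfl fun l _ => by ring

theorem totalDegree_linForm_add_nsmul_pow_three_le (n : ℕ) :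
    ((linForm A i + n • linIncrement A i) ^ 3).totalDegree ≤ 9 := by
  have linForm_le : (linForm A i).totalDegree ≤ 3 :=
    (isHomogeneous_linForm A i).totalDegree_le.trans (by norm_num)
  have nsmul_le : (n • linIncrement A i).totalDegree ≤ 3 :=
    (totalDegree_smul_le _ _).trans (isHomogeneous_linIncrement A i).totalDegree_le
  have add_le : (linForm A i + n • linIncrement A i).totalDegree ≤ 3 :=
    (totalDegree_add _ _).trans (max_le linForm_le nsmul_le)
  exact (totalDegree_pow _ _).trans (Nat.mul_le_mul_left 3 add_le)

section Nilpotent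

variable {A}

theorem mkDerivation_linIncrement (h3 : (3 : K) ≠ 0) (hJ : jacobian (cubicPart A) ^ 3 = 0) :
    mkDerivation K (cubicPart A) (linIncrement A i) = 0 := by
  set D := mkDerivation K (cubicPart A)
  have jacobian_sq : jacobian (cubicPart A) ^ 2 *ᵥ cubicPart A = 0 :=
    jacobian_pow_mulVec_self (mod_cast h3) (isHomogeneous_cubicPart A) hJ
  have derivation_cube : mkDerivation K (fun j => D (cubicPart A j)) (linForm A i ^ 3) = 0 := by
    rw [pow_two, ← Matrix.mulVec_mulVec, jacobian_mulVec, jacobian_mulVec] at jacobian_sq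
    exact congrFun jacobian_sq i
  have three_ne_zero : ((3 : ℕ) : MvPolynomial (Fin d) K) ≠ 0 := by
    rw [← map_natCast C, C_ne_zero]
    exact_mod_cast h3
  rw [linIncrement, derivation_sum_C_mul, ← mkDerivation_linForm]
  exact derivation_eq_zero_of_pow _ three_ne_zero derivation_cube

theorem bind₁_linIncrement (h6 : (6 : K) ≠ 0) (hJ : jacobian (cubicPart A) ^ 3 = 0) :
    bind₁ (idAdd (cubicPart A)) (linIncrement A i) = linIncrement A i := by
  set D := mkDerivation K (cubicPart A)
  have h3 : (3 : K) ≠ 0 := fun h => h6 (by linear_combination 2 * h)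
  have derivation_linForm (j : Fin d) : D (linForm A j) = linIncrement A j :=
    mkDerivation_linForm A j _
  have derivation_linIncrement_eq_zero (j : Fin d) : D (linIncrement A j) = 0 :=
    mkDerivation_linIncrement j h3 hJ
  have taylor : 6 * bind₁ (idAdd (cubicPart A)) (linIncrement A i) =
      6 * linIncrement A i + 6 * D (linIncrement A i) + 3 * D (D (linIncrement A i)) +
        D (D (D (linIncrement A i))) := by
    simp only [bind₁_linIncrement_eq_sum, Finset.mul_sum, mul_left_comm (6 : MvPolynomial _ K),
      six_mul_add_pow_three D (derivation_linForm _) (derivation_linIncrement_eq_zero _)]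
    simp only [linIncrement, derivation_sum_C_mul, Finset.mul_sum, ← Finset.sum_add_distrib]
    exact Finset.sum_congr rfl fun j _ => by rw [cubicPart]; ring
  have six_ne_zero : (6 : MvPolynomial (Fin d) K) ≠ 0 := by
    rwa [← map_ofNat C, C_ne_zero]
  simpa [derivation_linIncrement_eq_zero, six_ne_zero] using taylor

theorem pSeq_succ_eq_fwdDiff_iter (h6 : (6 : K) ≠ 0) (hJ : jacobian (cubicPart A) ^ 3 = 0)
    (j : ℕ) : pSeq (cubicPart A) i (j + 1) =
      (fwdDiff 1)^[j] (fun n : ℕ => (linForm A i + n • linIncrement A i) ^ 3) 0 := by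
  set σ := bind₁ (idAdd (cubicPart A))
  have iterate_linForm (n : ℕ) : σ^[n] (linForm A i) = linForm A i + n • linIncrement A i :=
    iterate_map_eq_add_nsmul σ (bind₁_linForm A i) (bind₁_linIncrement i h6 hJ) n
  calc pSeq (cubicPart A) i (j + 1)
      = (fun p => σ p - p)^[j] (linForm A i ^ 3) := pSeq_succ_eq_iterate (cubicPart A) i j
    _ = (fwdDiff 1)^[j] (fun n : ℕ => σ^[n] (linForm A i ^ 3)) 0 :=
      iterate_map_sub_self_eq_fwdDiff_iter σ j _
    _ = _ := by simp only [iterate_map_pow, iterate_linForm]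

theorem pSeq_four (h6 : (6 : K) ≠ 0) (hJ : jacobian (cubicPart A) ^ 3 = 0) :
    pSeq (cubicPart A) i 4 = 6 * linIncrement A i ^ 3 := by
  rw [pSeq_succ_eq_fwdDiff_iter i h6 hJ, fwdDiff_iter_three_add_nsmul_pow_three]

theorem pSeq_five (h6 : (6 : K) ≠ 0) (hJ : jacobian (cubicPart A) ^ 3 = 0) :
    pSeq (cubicPart A) i 5 = 0 := by
  rw [pSeq_succ_eq_fwdDiff_iter i h6 hJ, fwdDiff_iter_four_add_nsmul_pow_three]

theorem totalDegree_pSeq_succ_le (h6 : (6 : K) ≠ 0) (hJ : jacobian (cubicPart A) ^ 3 = 0)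
    (j : ℕ) : (pSeq (cubicPart A) i (j + 1)).totalDegree ≤ 9 := by
  rw [pSeq_succ_eq_fwdDiff_iter i h6 hJ]
  exact totalDegree_fwdDiff_iter_le 1 (totalDegree_linForm_add_nsmul_pow_three_le A i) j 0

end Nilpotent

end Druzkowski

theorem proposition3_general {K : Type*} [Field K] (h6 : (6 : K) ≠ 0) {d : ℕ}
    (A : Matrix (Fin d) (Fin d) K)
    (hJ : Druzkowski.jacobian (Druzkowski.cubicPart A) ^ 3 = 0) (i : Fin d) :
    (∀ j ∈ Finset.Icc 2 4, (Druzkowski.pSeq (Druzkowski.cubicPart A) i j).totalDegree ≤ 9) ∧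
    Druzkowski.pSeq (Druzkowski.cubicPart A) i 5 = 0 ∧
    Druzkowski.pSeq (Druzkowski.cubicPart A) i 4 =
      6 * ∑ j, ∑ k, ∑ l, MvPolynomial.C (A i j * A i k * A i l) *
        (Druzkowski.linForm A j ^ 3 * Druzkowski.linForm A k ^ 3 *
          Druzkowski.linForm A l ^ 3) := by
  refine ⟨fun j hj => ?_, Druzkowski.pSeq_five i h6 hJ, ?_⟩
  · obtain ⟨j, rfl⟩ := Nat.exists_eq_add_of_le' (one_le_two.trans (Finset.mem_Icc.mp hj).1)
    exact Druzkowski.totalDegree_pSeq_succ_le i h6 hJ j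
  · rw [Druzkowski.pSeq_four i h6 hJ, Druzkowski.linIncrement_pow_three]

theorem proposition3 {K : Type*} [Field K] [CharZero K] {d : ℕ}
    (A : Matrix (Fin d) (Fin d) K)
    (hJ : Druzkowski.jacobian (Druzkowski.cubicPart A) ^ 3 = 0) (i : Fin d) :
    (∀ j ∈ Finset.Icc 2 4, (Druzkowski.pSeq (Druzkowski.cubicPart A) i j).totalDegree ≤ 9) ∧
    Druzkowski.pSeq (Druzkowski.cubicPart A) i 5 = 0 ∧
    Druzkowski.pSeq (Druzkowski.cubicPart A) i 4 =
      6 * ∑ j, ∑ k, ∑ l, MvPolynomial.C (A i j * A i k * A i l) *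
        (Druzkowski.linForm A j ^ 3 * Druzkowski.linForm A k ^ 3 *
          Druzkowski.linForm A l ^ 3) :=
  proposition3_general (by norm_num) A hJ i
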